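/- All graphs are finite, simple and undirected. A \emph{propeller} is a graph that consists of a chordless cycle $C$ (of length at least $3$) and a node $x \notin V(C)$ that has at least two neighbors on $C$; that is, its node set is $V(C)\cup\{x\}$ and its edges are the edges of $C$ together with the edges joining $x$ to its neighbors on $C$. Let $\mathcal C_2$ be the class of graphs that do not contain a propeller as an induced subgraph, i.e. no induced subgraph of the graph is isomorphic to a propeller. An edge of a graph is \emph{pending} if at least one of its endnodes has degree $1$, and \emph{flat} if both of its endnodes have degree $2$. Then every graph $G$ in $\mathcal C_2$ with at least one edge contains an edge that is pending or flat. -/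

import Mathlib

namespace SimpleGraph

variable {V : Type*}

/-- The graph `G` is a propeller: it consists of a chordless cycle `C` (the rim) and a node `x`
outside `C` (the center) that has at least two neighbors on `C`. -/
def IsPropeller (G : SimpleGraph V) : Prop :=
  ∃ (u : V) (C : G.Walk u u) (x : V),
    C.IsCycle ∧ C.IsChordless ∧ x ∉ C.support ∧ (∀ w : V, w = x ∨ w ∈ C.support) ∧
      ∃ a ∈ C.support, ∃ b ∈ C.support, a ≠ b ∧ G.Adj x a ∧ G.Adj x b

/-- Membership in the class `C₂`: no induced subgraph of `G` is a propeller. -/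
def IsInducedPropellerFree (G : SimpleGraph V) : Prop :=
  ∀ S : Set V, ¬ (G.induce S).IsPropeller

/-- The edge `e` of `G` is pending: at least one of its endnodes has degree 1. -/
def IsPendingEdge (G : SimpleGraph V) [G.LocallyFinite] (e : Sym2 V) : Prop :=
  e ∈ G.edgeSet ∧ ∃ v ∈ e, G.degree v = 1

/-- The edge `e` of `G` is flat: both of its endnodes have degree 2. -/
def IsFlatEdge (G : SimpleGraph V) [G.LocallyFinite] (e : Sym2 V) : Prop :=
  e ∈ G.edgeSet ∧ ∀ v ∈ e, G.degree v = 2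

end SimpleGraph

/-!
Call a vertex set `R` *solid* if it induces a connected subgraph that has no clique cutset of one or
two vertices. In a propeller-free graph, any two vertices of a solid set with at least three
vertices lie in a common induced cycle (`IsSolid.exists_indCycle_pair`). Hence a vertex outside such
a set has at most one neighbor in it (`IsSolid.eq_of_adj`), since two of them would make it the
center of a propeller.

For the first claim, induced cycles through a fixed vertex `p` extend along edges
(`IsSolid.exists_indCycle_of_adj`). Let an induced cycle `O` contain `p` and `z`, let `q` be a
neighbor of `z` outside `O`, and let `M` be the component of `q` when `O` and the other neighbors of
`z` are removed. If `M` has a neighbor on `O` that is neither `z` nor adjacent to `z`, then `O` can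
be rerouted through `M` so as to contain `p` and `q`. Otherwise all attachments of `M` other than
`z` are neighbors of `z`; as neither `z` alone nor `z` with one further attachment is a cutset,
two of these attachments are linked outside `M` as well as through `M`, and this gives an induced
cycle on which `z`, a vertex outside it, has two neighbors.

The edge is found by descent on a connected set `X` whose outer neighbors lie in a solid set `R`
disjoint from `X`, each vertex of `X` having at most one neighbor in `R` (`IsAttached`). Such an `X`
contains a shortest ear whose feet are either nonadjacent, or the only outer neighbors of `X`; the
remaining possibility is that `X` has a single outer neighbor, with a single neighbor `u` in `X`.
Adding the ear to `R` (or to its feet alone, if these are the only outer neighbors) gives a solid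
set again (`IsSolid.union_ear`), to which every component of the rest of `X` is attached. If nothing
of `X` remains, the ear has two vertices of degree two in a row. In the remaining case `u` takes the
role of `R`, or `X = {u}` and `u` has degree one.
-/

namespace SimpleGraph

variable {V : Type*} {G : SimpleGraph V}

/-! ### Connectedness inside a vertex set -/

/-- `u` and `w` are joined by a walk of `G` all of whose vertices lie in `Y`. -/
def LinkedIn (G : SimpleGraph V) (Y : Set V) (u w : V) : Prop :=
  ∃ p : G.Walk u w, ∀ x ∈ p.support, x ∈ Y

/-- The vertex set `Y` is empty or induces a connected subgraph of `G`. -/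
def ConnectedIn (G : SimpleGraph V) (Y : Set V) : Prop :=
  ∀ u ∈ Y, ∀ w ∈ Y, G.LinkedIn Y u w

namespace LinkedIn

variable {Y Z : Set V} {u v w : V}

theorem refl (h : u ∈ Y) : G.LinkedIn Y u u := ⟨.nil, by simpa using h⟩

theorem symm (h : G.LinkedIn Y u w) : G.LinkedIn Y w u := by
  obtain ⟨p, hp⟩ := h
  exact ⟨p.reverse, by simpa using hp⟩

theorem trans (h : G.LinkedIn Y u v) (h' : G.LinkedIn Y v w) : G.LinkedIn Y u w := by
  obtain ⟨p, hp⟩ := h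
  obtain ⟨q, hq⟩ := h'
  refine ⟨p.append q, fun x hx => ?_⟩
  rcases (Walk.mem_support_append_iff p q).1 hx with h | h
  exacts [hp x h, hq x h]

theorem mono (h : G.LinkedIn Y u w) (hYZ : Y ⊆ Z) : G.LinkedIn Z u w := by
  obtain ⟨p, hp⟩ := h
  exact ⟨p, fun x hx => hYZ (hp x hx)⟩

theorem left_mem (h : G.LinkedIn Y u w) : u ∈ Y := by
  obtain ⟨p, hp⟩ := h
  exact hp _ p.start_mem_support

theorem right_mem (h : G.LinkedIn Y u w) : w ∈ Y := h.symm.left_mem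

theorem of_adj (hu : u ∈ Y) (hw : w ∈ Y) (h : G.Adj u w) : G.LinkedIn Y u w :=
  ⟨.cons h .nil, by simp [hu, hw]⟩

/-- A walk that leaves a set `D` does so along some edge. -/
theorem exists_exit (h : G.LinkedIn Y u w) {D : Set V} (hu : u ∈ D) (hw : w ∉ D) :
    ∃ x ∈ D, ∃ y ∉ D, x ∈ Y ∧ y ∈ Y ∧ G.Adj x y := by
  obtain ⟨p, hp⟩ := h
  obtain ⟨d, hd, h1, h2⟩ := p.exists_boundary_dart D hu hw
  exact ⟨_, h1, _, h2, hp _ (p.dart_fst_mem_support_of_mem_darts hd),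
    hp _ (p.dart_snd_mem_support_of_mem_darts hd), d.adj⟩

end LinkedIn

/-- The component of `u` in `Y` is connected. -/
theorem connectedIn_setOf_linkedIn (Y : Set V) (u : V) : G.ConnectedIn {x | G.LinkedIn Y u x} := by
  have key : ∀ x, G.LinkedIn Y u x → G.LinkedIn {x | G.LinkedIn Y u x} u x := by
    rintro x ⟨p, hp⟩
    classical
    refine ⟨p, fun y hy => ⟨p.takeUntil y hy, fun z hz => hp z ?_⟩⟩
    exact p.support_takeUntil_subset_support hy hz
  exact fun x hx y hy => (key x hx).symm.trans (key y hy)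

/-! ### Induced paths -/

/-- `S` is the vertex set of an induced path of `G` with ends `a` and `b` (which are equal exactly
when the path is a single vertex). -/
inductive IndPath (G : SimpleGraph V) : V → V → Set V → Prop
  | single (a : V) : IndPath G a a {a}
  | cons {a b c : V} {S : Set V} : G.Adj a b → IndPath G b c S → a ∉ S →
      (∀ x ∈ S, G.Adj a x → x = b) → IndPath G a c (insert a S)

namespace IndPath

variable {S T Y : Set V} {a b c d t : V}

theorem left_mem (h : G.IndPath a b S) : a ∈ S := by
  cases h <;> simp

theorem right_mem (h : G.IndPath a b S) : b ∈ S := by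
  induction h with
  | single a => simp
  | cons _ _ _ _ ih => exact Or.inr ih

theorem append (h : G.IndPath a b S) (h' : G.IndPath c d T) (hbc : G.Adj b c)
    (hd : Disjoint S T) (hST : ∀ x ∈ S, ∀ y ∈ T, G.Adj x y → x = b ∧ y = c) :
    G.IndPath a d (S ∪ T) := by
  induction h with
  | single a =>
    rw [Set.singleton_union]
    exact .cons hbc h' (by simpa using hd) fun x hx hax => (hST _ rfl x hx hax).2
  | @cons a a' b S haa' hS haS hadj ih =>
    rw [Set.insert_union]
    rw [Set.disjoint_insert_left] at hd
    refine .cons haa' (ih hbc hd.2 fun x hx => hST x (Or.inr hx)) ?_ ?_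
    · rintro (h | h)
      exacts [haS h, hd.1 h]
    · rintro x (hx | hx) hax
      · exact hadj x hx hax
      · exact absurd ((hST a (Or.inl rfl) x hx hax).1 ▸ hS.right_mem) haS

theorem symm (h : G.IndPath a b S) : G.IndPath b a S := by
  induction h with
  | single a => exact .single a
  | @cons a a' b S haa' hS haS hadj ih =>
    rw [Set.insert_eq, Set.union_comm]
    refine ih.append (.single a) haa'.symm (by simpa using haS) ?_
    rintro x hx y rfl hxy
    exact ⟨hadj x hx hxy.symm, rfl⟩

theorem connectedIn (h : G.IndPath a b S) : G.ConnectedIn S := by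
  have key : ∀ x ∈ S, G.LinkedIn S a x := by
    induction h with
    | single a => rintro x rfl; exact .refl rfl
    | @cons a a' b S haa' hS haS hadj ih =>
      rintro x (rfl | hx)
      · exact .refl (Or.inl rfl)
      · exact (LinkedIn.of_adj (Set.mem_insert _ _) (Set.mem_insert_of_mem _ hS.left_mem)
          haa').trans ((ih x hx).mono (Set.subset_insert _ _))
  exact fun x hx y hy => (key x hx).symm.trans (key y hy)

theorem exists_eq_insert (h : G.IndPath a b S) (hab : a ≠ b) :
    ∃ a' S', S = insert a S' ∧ a ∉ S' ∧ G.Adj a a' ∧ G.IndPath a' b S' ∧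
      ∀ x ∈ S', G.Adj a x → x = a' := by
  cases h with
  | single => exact absurd rfl hab
  | cons h1 h2 h3 h4 => exact ⟨_, _, rfl, h3, h1, h2, h4⟩

theorem exists_split (h : G.IndPath a b S) (ht : t ∈ S) :
    ∃ S₁ S₂, S = S₁ ∪ S₂ ∧ G.IndPath a t S₁ ∧ G.IndPath t b S₂ ∧
      (t ≠ a → a ∉ S₂) ∧ (t ≠ b → b ∉ S₁) := by
  induction h with
  | single a =>
    obtain rfl := ht
    exact ⟨_, _, (Set.union_self _).symm, .single t, .single t, by simp, by simp⟩
  | @cons a a' b S haa' hS haS hadj ih =>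
    rcases ht with rfl | ht
    · exact ⟨{t}, insert t S, by simp, .single t, .cons haa' hS haS hadj, by simp,
        fun h h' => h h'.symm⟩
    · obtain ⟨S₁, S₂, rfl, h1, h2, h3, h4⟩ := ih ht
      refine ⟨insert a S₁, S₂, by rw [Set.insert_union], .cons haa' h1 (fun h => haS (Or.inl h))
        fun x hx => hadj x (Or.inl hx), h2, fun _ h => haS (Or.inr h), fun htb h => ?_⟩
      rcases h with rfl | h
      exacts [haS hS.right_mem, h4 htb h]

theorem connectedIn_diff_left (h : G.IndPath a b S) : G.ConnectedIn (S \ {a}) := by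
  by_cases hab : a = b
  · subst hab
    cases h with
    | single => rintro x ⟨h1, h2⟩; exact absurd h1 h2
    | cons h1 h2 h3 h4 => exact absurd h2.right_mem h3
  · obtain ⟨a', S', rfl, h1, -, h2, -⟩ := h.exists_eq_insert hab
    rw [Set.insert_sdiff_of_mem _ (Set.mem_singleton a), Set.sdiff_singleton_eq_self h1]
    exact h2.connectedIn

theorem connectedIn_diff_right (h : G.IndPath a b S) : G.ConnectedIn (S \ {b}) :=
  h.symm.connectedIn_diff_left

/-- After the deletion of a vertex or of two adjacent vertices, every remaining vertex of an
induced path is still linked to one of the ends. -/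
theorem linkedIn_diff_pair (h : G.IndPath a b S) {x y w : V} (hxy : x = y ∨ G.Adj x y)
    (hw : w ∈ S \ {x, y}) :
    G.LinkedIn (S \ {x, y}) w a ∨ G.LinkedIn (S \ {x, y}) w b := by
  induction h with
  | single a =>
    obtain rfl : w = a := hw.1
    exact .inl (.refl hw)
  | @cons a a' b S haa' hS haS hadj ih =>
    have hsub : S \ {x, y} ⊆ insert a S \ {x, y} := Set.sdiff_subset_sdiff_left (by simp)
    obtain ⟨rfl | hwS, hwxy⟩ := hw
    · exact .inl (.refl ⟨Or.inl rfl, hwxy⟩)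
    rcases ih ⟨hwS, hwxy⟩ with h | h
    · by_cases ha : a ∈ ({x, y} : Set V)
      · right
        have hdis : S ⊆ insert a S \ {x, y} := by
          have ha' := h.right_mem
          intro z hz
          refine ⟨Or.inr hz, ?_⟩
          simp only [Set.mem_insert_iff, Set.mem_singleton_iff, Set.mem_sdiff] at *
          have := hadj z hz
          grind [G.adj_comm]
        exact (hS.connectedIn w hwS _ hS.right_mem).mono hdis
      · exact .inl ((h.mono hsub).trans
          (.of_adj (hsub h.right_mem) ⟨Or.inl rfl, ha⟩ haa'.symm))
    · exact .inr (h.mono hsub)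

/-- A vertex with a neighbor on an induced path can be joined to the far end by an induced path
through vertices of the given path. -/
theorem exists_cons (h : G.IndPath b c S) (ha : a ∉ S) (hab : ∃ x ∈ S, G.Adj a x) :
    ∃ T ⊆ insert a S, G.IndPath a c T := by
  induction h with
  | single b =>
    obtain ⟨x, rfl, hx⟩ := hab
    exact ⟨_, subset_rfl, .cons hx (.single x) ha (by simp)⟩
  | @cons b b' c S hbb' hS hbS hadj ih =>
    by_cases h : ∃ x ∈ S, G.Adj a x
    · obtain ⟨T, hT, h'⟩ := ih (fun h => ha (Or.inr h)) h
      exact ⟨T, hT.trans (Set.insert_subset_insert (Set.subset_insert _ _)), h'⟩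
    · have hx : ∀ x ∈ insert b S, G.Adj a x → x = b := by
        rintro x (rfl | hx) hax
        exacts [rfl, absurd ⟨x, hx, hax⟩ h]
      obtain ⟨x, hxS, hax⟩ := hab
      exact ⟨_, subset_rfl, .cons (hx x hxS hax ▸ hax) (.cons hbb' hS hbS hadj) ha hx⟩

theorem exists_walk (h : G.IndPath a b S) :
    ∃ p : G.Walk a b, p.IsPath ∧ p.IsChordless ∧ ∀ x, x ∈ p.support ↔ x ∈ S := by
  induction h with
  | single a =>
    refine ⟨.nil, by simp, ?_, by simp⟩
    rw [Walk.isChordless_iff_forall_mem_edges]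
    simp +contextual
  | @cons a a' b S haa' hS haS hadj ih =>
    obtain ⟨p, h1, h2, h3⟩ := ih
    refine ⟨.cons haa' p, by simp [h1, h3, haS], ?_, by simp [h3]⟩
    rw [Walk.isChordless_iff_forall_mem_edges] at h2 ⊢
    intro u v hu hv huv
    simp only [Walk.support_cons, List.mem_cons, Walk.edges_cons, h3] at h2 hu hv ⊢
    rcases hu with rfl | hu <;> rcases hv with rfl | hv
    · exact absurd huv (G.loopless.irrefl _)
    · exact .inl (by rw [hadj v hv huv])
    · exact .inl (by rw [hadj u hu huv.symm, Sym2.eq_swap])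
    · exact .inr (h2 hu hv huv)

end IndPath

theorem LinkedIn.exists_indPath {Y : Set V} {u w : V} (h : G.LinkedIn Y u w) :
    ∃ S ⊆ Y, G.IndPath u w S := by
  obtain ⟨p, hp⟩ := h
  induction p with
  | nil => exact ⟨_, by simpa using hp, .single _⟩
  | @cons u v w huv p ih =>
    simp only [Walk.support_cons, List.mem_cons, forall_eq_or_imp] at hp
    obtain ⟨S, hS, h⟩ := ih hp.2
    by_cases hu : u ∈ S
    · obtain ⟨S₁, S₂, rfl, -, h2, -⟩ := h.exists_split hu
      exact ⟨S₂, Set.subset_union_right.trans hS, h2⟩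
    · obtain ⟨T, hT, h'⟩ := h.exists_cons hu ⟨v, h.left_mem, huv⟩
      exact ⟨T, hT.trans (Set.insert_subset hp.1 hS), h'⟩

/-- Any two vertices of an induced path that are not its two ends are joined by a shorter one. -/
theorem IndPath.exists_ssubset {S : Set V} {a b x y : V} (h : G.IndPath a b S) (hx : x ∈ S)
    (hy : y ∈ S) (hxy : ¬ (x = a ∧ y = b ∨ x = b ∧ y = a)) : ∃ T ⊂ S, G.IndPath x y T := by
  have key : ∀ c ∈ S, G.ConnectedIn (S \ {c}) → x ≠ c → y ≠ c → ∃ T ⊂ S, G.IndPath x y T := by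
    intro c hc hconn hxc hyc
    obtain ⟨T, hT, h'⟩ := (hconn x ⟨hx, hxc⟩ y ⟨hy, hyc⟩).exists_indPath
    exact ⟨T, hT.trans_ssubset (Set.sdiff_singleton_ssubset.2 hc), h'⟩
  by_cases h1 : x ≠ a ∧ y ≠ a
  · exact key a h.left_mem h.connectedIn_diff_left h1.1 h1.2
  by_cases h2 : x ≠ b ∧ y ≠ b
  · exact key b h.right_mem h.connectedIn_diff_right h2.1 h2.2
  have hab : a = b → S = {a} := by
    rintro rfl
    cases h with
    | single => rfl
    | cons _ h _ _ => exact absurd h.right_mem ‹_›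
  by_cases h3 : a = b
  · rw [hab h3] at hx hy
    exact absurd (.inl ⟨hx, hy.trans h3⟩) hxy
  · grind

/-- Among the induced paths in `Y` whose ends are related by `Q`, a shortest one has no other
pair of `Q`-related vertices. -/
theorem LinkedIn.exists_shortest_indPath [Finite V] {Y : Set V} {u w : V} (h : G.LinkedIn Y u w)
    (Q : V → V → Prop) (hQ : Q u w) :
    ∃ a b S, S ⊆ Y ∧ G.IndPath a b S ∧ Q a b ∧
      ∀ x ∈ S, ∀ y ∈ S, Q x y → x = a ∧ y = b ∨ x = b ∧ y = a := by
  obtain ⟨S, hSY, hS⟩ := h.exists_indPath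
  clear h
  induction hn : S.ncard using Nat.strong_induction_on generalizing u w S with
  | _ n ih =>
    subst hn
    by_cases h1 : ∀ x ∈ S, ∀ y ∈ S, Q x y → x = u ∧ y = w ∨ x = w ∧ y = u
    · exact ⟨u, w, S, hSY, hS, hQ, h1⟩
    · push Not at h1
      obtain ⟨x, hx, y, hy, hQxy, hne⟩ := h1
      obtain ⟨T, hT, h'⟩ := hS.exists_ssubset hx hy (by tauto)
      exact ih _ (Set.ncard_lt_ncard hT) hQxy T (hT.subset.trans hSY) h' rfl

/-- Among the induced paths in `Y` whose ends are related by `Q`, a shortest one has no other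
vertex that is `Q`-related to one of its ends. -/
theorem LinkedIn.exists_minimal_indPath [Finite V] {Y : Set V} {u w : V} (h : G.LinkedIn Y u w)
    (Q : V → V → Prop) (hQ : Q u w) :
    ∃ a b S, S ⊆ Y ∧ G.IndPath a b S ∧ Q a b ∧ (∀ x ∈ S, Q a x → x = b) ∧
      ∀ x ∈ S, Q x b → x = a := by
  obtain ⟨a, b, S, hSY, hS, hab, h⟩ := h.exists_shortest_indPath Q hQ
  refine ⟨a, b, S, hSY, hS, hab, fun x hx hax => ?_, fun x hx hxb => ?_⟩
  · rcases h a hS.left_mem x hx hax with h | h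
    exacts [h.2, h.2.trans h.1]
  · rcases h x hx b hS.right_mem hxb with h | h
    exacts [h.1, h.1.trans h.2]

/-! ### Induced cycles -/

/-- `O` is the vertex set of an induced cycle of `G` through `z`: an induced path together with the
vertex `z`, whose neighbors on the path are its two ends. -/
def IndCycle (G : SimpleGraph V) (z : V) (O : Set V) : Prop :=
  ∃ a b S, O = insert z S ∧ G.IndPath a b S ∧ a ≠ b ∧ z ∉ S ∧ ∀ x ∈ S, G.Adj z x ↔ x = a ∨ x = b

theorem IndCycle.mem {z : V} {O : Set V} (h : G.IndCycle z O) : z ∈ O := by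
  obtain ⟨a, b, S, rfl, -⟩ := h
  exact Or.inl rfl

/-- Two disjoint induced paths, with exactly two edges between them, which join their
ends, form an induced cycle. -/
theorem IndPath.indCycle_union {S T : Set V} {a b c d : V} (h : G.IndPath a b S)
    (h' : G.IndPath c d T) (hab : a ≠ b) (hd : Disjoint S T)
    (hST : ∀ x ∈ S, ∀ y ∈ T, G.Adj x y ↔ x = b ∧ y = c ∨ x = a ∧ y = d) :
    G.IndCycle a (S ∪ T) := by
  obtain ⟨a', S', rfl, h1, h2, h3, h4⟩ := h.exists_eq_insert hab
  rw [Set.disjoint_insert_left] at hd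
  refine ⟨a', d, S' ∪ T, by rw [Set.insert_union], ?_, ?_, ?_, ?_⟩
  · refine h3.append h' ((hST b h.right_mem c h'.left_mem).2 (.inl ⟨rfl, rfl⟩)) hd.2 ?_
    intro x hx y hy hxy
    rcases (hST x (Or.inr hx) y hy).1 hxy with h | h
    exacts [h, absurd (h.1 ▸ hx) h1]
  · rintro rfl
    exact Set.disjoint_left.1 hd.2 h3.left_mem h'.right_mem
  · rintro (h | h)
    exacts [h1 h, hd.1 h]
  · rintro x (hx | hx)
    · refine ⟨fun h => .inl (h4 x hx h), ?_⟩
      rintro (rfl | rfl)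
      exacts [h2, absurd h'.right_mem (Set.disjoint_left.1 hd.2 hx)]
    · rw [hST a (Or.inl rfl) x hx]
      refine ⟨?_, ?_⟩
      · rintro (h | h)
        exacts [absurd h.1 hab, .inr h.2]
      · rintro (rfl | rfl)
        exacts [absurd hx (Set.disjoint_left.1 hd.2 h3.left_mem), .inr ⟨rfl, rfl⟩]

theorem IndCycle.exists_walk {z : V} {O : Set V} (h : G.IndCycle z O) :
    ∃ C : G.Walk z z, C.IsCycle ∧ C.IsChordless ∧ ∀ x, x ∈ C.support ↔ x ∈ O := by
  obtain ⟨a, b, S, rfl, hS, hab, hz, hadj⟩ := h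
  obtain ⟨p, h1, h2, h3⟩ := hS.exists_walk
  have hza : G.Adj z a := (hadj a hS.left_mem).2 (.inl rfl)
  have hbz : G.Adj b z := ((hadj b hS.right_mem).2 (.inr rfl)).symm
  have hsz : s(z, a) ∉ p.edges := fun h => hz ((h3 z).1 (p.fst_mem_support_of_mem_edges h))
  refine ⟨.cons hza (p.concat hbz), ?_, ?_, ?_⟩
  · rw [Walk.cons_isCycle_iff, Walk.concat_isPath_iff]
    refine ⟨⟨h1, by rwa [h3]⟩, ?_⟩
    rw [Walk.edges_concat, List.concat_eq_append, List.mem_append]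
    rintro (h | h)
    · exact hsz h
    · have := hza.ne
      simp at h
      grind
  · rw [Walk.isChordless_iff_forall_mem_edges] at h2 ⊢
    intro u v hu hv huv
    simp only [Walk.support_cons, Walk.support_concat, List.concat_eq_append, List.mem_append,
      List.mem_cons, List.not_mem_nil, or_false, Walk.edges_cons, Walk.edges_concat, h3]
      at h2 hu hv ⊢
    have hu' : u = z ∨ u ∈ S := by tauto
    have hv' : v = z ∨ v ∈ S := by tauto
    rcases hu' with rfl | hu' <;> rcases hv' with rfl | hv'
    · exact absurd huv (G.loopless.irrefl _)
    · rcases (hadj v hv').1 huv with rfl | rfl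
      exacts [.inl rfl, .inr (.inr Sym2.eq_swap)]
    · rcases (hadj u hu').1 huv.symm with rfl | rfl
      exacts [.inl Sym2.eq_swap, .inr (.inr rfl)]
    · exact .inr (.inl (h2 hu' hv' huv))
  · intro x
    simp only [Walk.support_cons, Walk.support_concat, List.mem_append,
      List.mem_cons, List.not_mem_nil, or_false, h3, Set.mem_insert_iff]
    tauto

/-- A vertex outside an induced cycle has at most one neighbor on it, since the cycle and the
vertex would otherwise induce a propeller. -/
theorem IsInducedPropellerFree.eq_of_adj_indCycle (hG : G.IsInducedPropellerFree) {z x u v : V}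
    {O : Set V} (hO : G.IndCycle z O) (hx : x ∉ O) (hu : u ∈ O) (hv : v ∈ O) (hxu : G.Adj x u)
    (hxv : G.Adj x v) : u = v := by
  by_contra huv
  obtain ⟨C, h1, h2, h3⟩ := hO.exists_walk
  have hC : ∀ y ∈ C.support, y ∈ insert x O := fun y hy => Or.inr ((h3 y).1 hy)
  have hmap := C.map_induce hC
  have hs : ∀ y : (insert x O : Set V), y ∈ (C.induce _ hC).support ↔ (y : V) ∈ O := by
    intro y
    rw [← h3, Walk.support_induce]
    simp
  refine hG (insert x O) ⟨_, C.induce _ hC, ⟨x, Or.inl rfl⟩, ?_, ?_, ?_, ?_, ⟨u, Or.inr hu⟩, ?_,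
    ⟨v, Or.inr hv⟩, ?_, ?_, hxu, hxv⟩
  · exact Walk.IsCycle.of_map (f := (Embedding.induce _).toHom) (by rw [hmap]; exact h1)
  · rw [Walk.isChordless_iff_forall_mem_edges] at h2 ⊢
    intro y y' hy hy' hyy'
    have := h2 ((h3 _).2 ((hs y).1 hy)) ((h3 _).2 ((hs y').1 hy')) hyy'
    have hedges : C.edges = (C.induce _ hC).edges.map (Sym2.map Subtype.val) :=
      (congrArg Walk.edges hmap).symm.trans (Walk.edges_map _ _)
    rw [hedges, List.mem_map] at this
    obtain ⟨e, he, he'⟩ := this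
    have : e = s(y, y') := by
      refine Sym2.map.injective Subtype.val_injective ?_
      simpa using he'
    rwa [← this]
  · rwa [hs]
  · rintro ⟨w, rfl | hw⟩
    · exact .inl rfl
    · exact .inr ((hs _).2 hw)
  · rwa [hs]
  · rwa [hs]
  · exact fun h => huv (congrArg Subtype.val h)

/-! ### Solid sets and their induced cycles -/

/-- The set `R` induces a connected subgraph without a clique cutset of at most two vertices. Sets
with at most two vertices are allowed. -/
def IsSolid (G : SimpleGraph V) (R : Set V) : Prop :=
  G.ConnectedIn R ∧ ∀ x y, x = y ∨ G.Adj x y → G.ConnectedIn (R \ {x, y})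

/-- A solid set with at least three vertices contains an induced cycle through each of its
vertices. -/
theorem IsSolid.exists_indCycle [Finite V] {R : Set V} (hR : G.IsSolid R) (h3 : 3 ≤ R.ncard) {p : V}
    (hp : p ∈ R) : ∃ O ⊆ R, G.IndCycle p O := by
  obtain ⟨n, hnR, hpn⟩ : ∃ n ∈ R, G.Adj p n := by
    obtain ⟨w, hw, hwp⟩ := Set.exists_ne_of_one_lt_ncard (by omega : 1 < R.ncard) p
    obtain ⟨x, rfl, y, -, -, hy, hxy⟩ := (hR.1 p hp w hw).exists_exit (D := {p}) rfl hwp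
    exact ⟨y, hy, hxy⟩
  obtain ⟨n', hnR', hpn', hne⟩ : ∃ n' ∈ R, G.Adj p n' ∧ n' ≠ n := by
    obtain ⟨w, hw, hwp⟩ : ∃ w ∈ R \ {n}, w ≠ p := by
      refine Set.exists_ne_of_one_lt_ncard ?_ p
      have := Set.ncard_sdiff_singleton_add_one hnR
      omega
    have hlink := hR.2 n n (.inl rfl)
    rw [Set.pair_eq_singleton] at hlink
    obtain ⟨x, rfl, y, -, -, hy, hxy⟩ :=
      (hlink p ⟨hp, hpn.ne⟩ w hw).exists_exit (D := {p}) rfl hwp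
    exact ⟨y, hy.1, hxy, hy.2⟩
  have hlink := hR.2 p p (.inl rfl)
  rw [Set.pair_eq_singleton] at hlink
  obtain ⟨a, b, S, hSR, hS, ⟨hpa, hpb, hab⟩, h1, -⟩ :=
    (hlink n ⟨hnR, hpn.ne'⟩ n' ⟨hnR', hpn'.ne'⟩).exists_minimal_indPath
      (fun u w => G.Adj p u ∧ G.Adj p w ∧ u ≠ w) ⟨hpn, hpn', hne.symm⟩
  refine ⟨insert p S, Set.insert_subset hp (hSR.trans Set.sdiff_subset), a, b, S, rfl, hS, hab,
    fun h => (hSR h).2 rfl, fun x hx => ⟨fun hpx => ?_, ?_⟩⟩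
  · by_contra! h
    exact h.2 (h1 x hx ⟨hpa, hpx, h.1.symm⟩)
  · rintro (rfl | rfl) <;> assumption

section Reroute

variable {Q Q₂ E : Set V} {z q p a b e t : V}

/-- Let `z` and an induced path `Q` from `a` to `b` form an induced cycle. An induced path `E` from
a further neighbor `q` of `z` to a neighbor of the inner vertex `t` of `Q`, the part `Q₂` of `Q`
from `t` to `b`, and `z` form an induced cycle. -/
theorem IndPath.indCycle_reroute (hQ₂ : G.IndPath t b Q₂) (hQ : Q₂ ⊆ Q) (ha : a ∉ Q₂)
    (hzQ : z ∉ Q) (hz : ∀ x ∈ Q, G.Adj z x ↔ x = a ∨ x = b) (hE : G.IndPath q e E) (hzE : z ∉ E)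
    (hEz : ∀ x ∈ E, G.Adj z x ↔ x = q) (hd : Disjoint E Q) (hqQ : ∀ x ∈ Q, ¬ G.Adj q x)
    (het : G.Adj e t) (hEQ : ∀ x ∈ E, ∀ y ∈ Q, y ≠ a → G.Adj x y → x = e ∧ y = t) :
    G.IndCycle q (E ∪ Q₂ ∪ {z}) := by
  have hqe : q ≠ e := by
    rintro rfl
    exact hqQ t (hQ hQ₂.left_mem) het
  obtain ⟨q', E', rfl, h1, h2, h3, h4⟩ := hE.exists_eq_insert hqe
  rw [Set.disjoint_insert_left] at hd
  have hEQ₂ : Disjoint E' Q₂ := hd.2.mono_right hQ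
  have hbz : G.Adj b z := ((hz b (hQ hQ₂.right_mem)).2 (.inr rfl)).symm
  have hzq : G.Adj z q := (hEz q (Or.inl rfl)).2 rfl
  have hpath : G.IndPath q' b (E' ∪ Q₂) := by
    refine h3.append hQ₂ het hEQ₂ fun x hx y hy hxy => hEQ x (Or.inr hx) y (hQ hy) ?_ hxy
    rintro rfl
    exact ha hy
  refine ⟨q', z, E' ∪ Q₂ ∪ {z}, by simp only [Set.insert_union], ?_, ?_, ?_, ?_⟩
  · refine hpath.append (.single z) hbz ?_ ?_
    · rw [Set.disjoint_singleton_right]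
      rintro (h | h)
      exacts [hzE (Or.inr h), hzQ (hQ h)]
    · rintro x (hx | hx) y rfl hxy
      · exact absurd ((hEz x (Or.inr hx)).1 hxy.symm ▸ hx) h1
      · rcases (hz x (hQ hx)).1 hxy.symm with rfl | h
        exacts [absurd hx ha, ⟨h, rfl⟩]
  · rintro rfl
    exact hzE (Or.inr h3.left_mem)
  · rintro ((h | h) | h)
    exacts [h1 h, hd.1 (hQ h), hzE (Or.inl h.symm)]
  · rintro x ((hx | hx) | rfl)
    · refine ⟨fun h => .inl (h4 x hx h), ?_⟩
      rintro (rfl | rfl)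
      exacts [h2, hzq.symm]
    · refine ⟨fun h => absurd h (hqQ x (hQ hx)), ?_⟩
      rintro (rfl | rfl)
      exacts [absurd hx (Set.disjoint_left.1 hEQ₂ h3.left_mem), absurd (hQ hx) hzQ]
    · exact ⟨fun _ => .inr rfl, fun _ => hzq.symm⟩

/-- Let `z` and the induced path `Q` form an induced cycle, and let `E` be an induced path from a
further neighbor `q` of `z` to a neighbor of an inner vertex `t` of `Q`. Then some induced cycle
contains `q` and a prescribed vertex `p` of the old cycle. -/
theorem IsInducedPropellerFree.exists_indCycle_of_reroute [Finite V]
    (hG : G.IsInducedPropellerFree) (hQ : G.IndPath a b Q)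
    (hab : a ≠ b) (hzQ : z ∉ Q) (hz : ∀ x ∈ Q, G.Adj z x ↔ x = a ∨ x = b)
    (hE : G.IndPath q e E) (hzE : z ∉ E) (hEz : ∀ x ∈ E, G.Adj z x ↔ x = q) (hd : Disjoint E Q)
    (hqQ : ∀ x ∈ Q, ¬ G.Adj q x) (ht : t ∈ Q) (hta : t ≠ a) (htb : t ≠ b) (het : G.Adj e t)
    (hEQ : ∀ x ∈ E, ∀ y ∈ Q, y ≠ a → y ≠ b → G.Adj x y → x = e ∧ y = t)
    (hp : p ∈ insert z Q) : ∃ O ⊆ E ∪ insert z Q, G.IndCycle q O ∧ p ∈ O := by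
  have hcyc : G.IndCycle z (insert z Q) := ⟨a, b, Q, rfl, hQ, hab, hzQ, hz⟩
  have hE' : ∀ x ∈ E, ∀ y ∈ Q, ∀ y' ∈ Q, G.Adj x y → G.Adj x y' → y = y' := by
    intro x hx y hy y' hy' h h'
    refine hG.eq_of_adj_indCycle hcyc ?_ (Or.inr hy) (Or.inr hy') h h'
    rintro (rfl | h)
    exacts [hzE hx, Set.disjoint_left.1 hd hx h]
  have hza : G.Adj z a := (hz a hQ.left_mem).2 (.inl rfl)
  have hzb : G.Adj z b := (hz b hQ.right_mem).2 (.inr rfl)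
  have haE : a ∉ E := fun h => Set.disjoint_left.1 hd h hQ.left_mem
  have hbE : b ∉ E := fun h => Set.disjoint_left.1 hd h hQ.right_mem
  have hz' : ∀ x ∈ Q, G.Adj z x ↔ x = b ∨ x = a := fun x hx => by rw [hz x hx, or_comm]
  have hsub : ∀ {Q'}, Q' ⊆ Q → E ∪ Q' ∪ {z} ⊆ E ∪ insert z Q := by
    rintro Q' h x ((hx | hx) | rfl)
    exacts [.inl hx, .inr (.inr (h hx)), .inr (.inl rfl)]
  obtain ⟨Q₁, Q₂, hQQ, hQ₁, hQ₂, ha, hb⟩ := hQ.exists_split ht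
  have hQ₁Q : Q₁ ⊆ Q := hQQ ▸ Set.subset_union_left
  have hQ₂Q : Q₂ ⊆ Q := hQQ ▸ Set.subset_union_right
  by_cases hEa : ∃ x ∈ E, G.Adj x a <;> by_cases hEb : ∃ x ∈ E, G.Adj x b
  · -- the part of `E` between neighbors of `a` and `b` closes `Q` to a cycle, with center `z`
    exfalso
    obtain ⟨x, hx, hxa⟩ := hEa
    obtain ⟨y, hy, hyb⟩ := hEb
    have hxe : x ≠ e := by
      rintro rfl
      exact hta (hE' x hx t ht a hQ.left_mem het hxa)
    have hye : y ≠ e := by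
      rintro rfl
      exact htb (hE' y hy t ht b hQ.right_mem het hyb)
    obtain ⟨f, f', F, hFE, hF, ⟨hfa, hfb⟩, h1, h2⟩ :=
      (hE.connectedIn_diff_right x ⟨hx, hxe⟩ y ⟨hy, hye⟩).exists_minimal_indPath
        (fun u w => G.Adj u a ∧ G.Adj w b) ⟨hxa, hyb⟩
    have hFQ : Disjoint F Q := hd.mono_left (hFE.trans Set.sdiff_subset)
    have := hQ.indCycle_union hF.symm hab hFQ.symm (by
      intro u hu w hw
      constructor
      · intro huw
        by_cases hua : u = a
        · subst hua
          exact .inr ⟨rfl, h2 w hw ⟨huw.symm, hfb⟩⟩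
        · by_cases hub : u = b
          · subst hub
            exact .inl ⟨rfl, h1 w hw ⟨hfa, huw.symm⟩⟩
          · exact absurd (hEQ w (hFE hw).1 u hu hua hub huw.symm).1 (hFE hw).2
      · rintro (⟨rfl, rfl⟩ | ⟨rfl, rfl⟩)
        exacts [hfb.symm, hfa.symm])
    refine hab (hG.eq_of_adj_indCycle this ?_ (.inl hQ.left_mem) (.inl hQ.right_mem) hza hzb)
    rintro (h | h)
    exacts [hzQ h, hzE (hFE h).1]
  · -- the rerouted cycle avoiding `a` has `a` as a center
    exfalso
    obtain ⟨x, hx, hxa⟩ := hEa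
    push Not at hEb
    have hc := hQ₂.indCycle_reroute hQ₂Q (ha hta) hzQ hz hE hzE hEz hd hqQ het
      (fun x hx y hy hya hxy => hEQ x hx y hy hya (fun h => hEb x hx (h ▸ hxy)) hxy)
    have := hG.eq_of_adj_indCycle hc (x := a) ?_ (.inr rfl) (.inl (.inl hx)) hza.symm hxa.symm
    · exact hzE (this ▸ hx)
    · rintro ((h | h) | h)
      exacts [haE h, ha hta h, hza.ne' h]
  · exfalso
    obtain ⟨x, hx, hxb⟩ := hEb
    push Not at hEa
    have hc := hQ₁.symm.indCycle_reroute hQ₁Q (hb htb) hzQ hz' hE hzE hEz hd hqQ het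
      (fun x hx y hy hyb hxy => hEQ x hx y hy (fun h => hEa x hx (h ▸ hxy)) hyb hxy)
    have := hG.eq_of_adj_indCycle hc (x := b) ?_ (.inr rfl) (.inl (.inl hx)) hzb.symm hxb.symm
    · exact hzE (this ▸ hx)
    · rintro ((h | h) | h)
      exacts [hbE h, hb htb h, hzb.ne' h]
  · push Not at hEa hEb
    have hEQ' : ∀ x ∈ E, ∀ y ∈ Q, G.Adj x y → x = e ∧ y = t := fun x hx y hy hxy =>
      hEQ x hx y hy (fun h => hEa x hx (h ▸ hxy)) (fun h => hEb x hx (h ▸ hxy)) hxy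
    have hp' : p ∈ E ∪ Q₁ ∪ {z} ∨ p ∈ E ∪ Q₂ ∪ {z} := by
      rw [hQQ] at hp
      simp only [Set.mem_insert_iff, Set.mem_union, Set.mem_singleton_iff] at hp ⊢
      tauto
    rcases hp' with hp' | hp'
    · exact ⟨_, hsub hQ₁Q, hQ₁.symm.indCycle_reroute hQ₁Q (hb htb) hzQ hz' hE hzE hEz hd hqQ het
        (fun x hx y hy _ hxy => hEQ' x hx y hy hxy), hp'⟩
    · exact ⟨_, hsub hQ₂Q, hQ₂.indCycle_reroute hQ₂Q (ha hta) hzQ hz hE hzE hEz hd hqQ het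
        (fun x hx y hy _ hxy => hEQ' x hx y hy hxy), hp'⟩

end Reroute

theorem IndCycle.of_adj {z q : V} {O : Set V} (h : G.IndCycle z O) (hq : q ∈ O)
    (hzq : G.Adj z q) : G.IndCycle q O := by
  have key : ∀ {a b S}, G.IndPath a b S → a ≠ b → z ∉ S →
      (∀ x ∈ S, G.Adj z x ↔ x = a ∨ x = b) → G.IndCycle a (insert z S) := by
    intro a b S hS hab hz hadj
    rw [Set.insert_eq, Set.union_comm]
    refine hS.indCycle_union (.single z) hab (by simpa using hz) ?_
    rintro x hx y rfl
    rw [G.adj_comm, hadj x hx, or_comm]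
    simp
  obtain ⟨a, b, S, rfl, hS, hab, hz, hadj⟩ := h
  rcases hq with rfl | hq
  · exact absurd hzq (G.loopless.irrefl _)
  rcases (hadj q hq).1 hzq with rfl | rfl
  · exact key hS hab hz hadj
  · exact key hS.symm hab.symm hz fun x hx => by rw [hadj x hx, or_comm]

/-- Induced cycles through `p` extend along edges: if one contains `z`, then one contains any
given neighbor `q` of `z`. The component `M` of `q` outside `O` and the other neighbors of `z`
either has a neighbor on `O` away from `z`, and the cycle can be rerouted through `q`; or `M`
attaches only to neighbors of `z`, two of which are linked both through `M` and around `M`,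
which gives an induced cycle with center `z`. -/
theorem IsSolid.exists_indCycle_of_adj [Finite V] {R O : Set V} {p z q : V} (hR : G.IsSolid R)
    (hG : G.IsInducedPropellerFree) (hOR : O ⊆ R) (hO : G.IndCycle z O) (hp : p ∈ O) (hq : q ∈ R)
    (hzq : G.Adj z q) : ∃ O' ⊆ R, G.IndCycle q O' ∧ p ∈ O' := by
  by_cases hqO : q ∈ O
  · exact ⟨O, hOR, hO.of_adj hqO hzq, hp⟩
  have hcyc := hO
  obtain ⟨a, b, Q, rfl, hQ, hab, hzQ, hz⟩ := hO
  have hQR : Q ⊆ R := fun x hx => hOR (Or.inr hx)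
  have hzR : z ∈ R := hOR (Or.inl rfl)
  have hqQ : ∀ x ∈ Q, ¬ G.Adj q x := by
    intro x hx hqx
    have := hG.eq_of_adj_indCycle hcyc hqO (Or.inr hx) (Or.inl rfl) hqx hzq.symm
    exact hzQ (this ▸ hx)
  set Y : Set V := {x ∈ R | x ≠ z ∧ x ∉ Q ∧ (G.Adj z x → x = q)} with hY
  set M : Set V := {x | G.LinkedIn Y q x} with hM
  have hqY : q ∈ Y := ⟨hq, hzq.ne', fun h => hqO (Or.inr h), fun _ => rfl⟩
  have hMY : M ⊆ Y := fun x hx => hx.right_mem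
  have hqM : q ∈ M := .refl hqY
  have hMconn : G.ConnectedIn M := connectedIn_setOf_linkedIn Y q
  by_cases hcase : ∃ m ∈ M, ∃ t ∈ Q, t ≠ a ∧ t ≠ b ∧ G.Adj m t
  · obtain ⟨m, hm, t, ht⟩ := hcase
    obtain ⟨q', e, E, hEM, hE, ⟨rfl, t, ht, hta, htb, het⟩, h1, -⟩ :=
      (hMconn q hqM m hm).exists_minimal_indPath
        (fun u w => u = q ∧ ∃ t ∈ Q, t ≠ a ∧ t ≠ b ∧ G.Adj w t) ⟨rfl, t, ht⟩
    have hd : Disjoint E Q := Set.disjoint_left.2 fun x hx => (hMY (hEM hx)).2.2.1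
    obtain ⟨O', hO', hc, hpO⟩ := hG.exists_indCycle_of_reroute hQ hab hzQ hz hE
      (fun h => (hMY (hEM h)).2.1 rfl)
      (fun x hx => ⟨(hMY (hEM hx)).2.2.2, fun h => h ▸ hzq⟩) hd hqQ ht hta htb het (by
        intro x hx y hy hya hyb hxy
        obtain rfl := h1 x hx ⟨rfl, y, hy, hya, hyb, hxy⟩
        refine ⟨rfl, hG.eq_of_adj_indCycle hcyc ?_ (Or.inr hy) (Or.inr ht) hxy het⟩
        rintro (rfl | h)
        exacts [(hMY (hEM hx)).2.1 rfl, (hMY (hEM hx)).2.2.1 h]) hp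
    refine ⟨O', fun x hx => ?_, hc, hpO⟩
    rcases hO' hx with h | h
    exacts [(hMY (hEM h)).1, hOR h]
  exfalso
  push Not at hcase
  set W : Set V := {x ∈ R | x ∉ M ∧ x ≠ z} with hW
  have hQW : Q ⊆ W := fun x hx => ⟨hQR hx, fun h => (hMY h).2.2.1 hx, fun h => hzQ (h ▸ hx)⟩
  -- the attachments of `M` other than `z` are neighbors of `z`
  have hatt : ∀ m ∈ M, ∀ x ∈ W, G.Adj m x → G.Adj z x := by
    intro m hm x hx hmx
    by_contra hzx
    by_cases hxQ : x ∈ Q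
    · have hxab : ¬ (x = a ∨ x = b) := fun h => hzx ((hz x hxQ).2 h)
      push Not at hxab
      exact hcase m hm x hxQ hxab.1 hxab.2 hmx
    · refine hx.2.1 (LinkedIn.trans hm (.of_adj (hMY hm) ⟨hx.1, hx.2.2, hxQ, ?_⟩ hmx))
      exact fun h => absurd h hzx
  set N : Set V := {x ∈ W | ∃ m ∈ M, G.Adj m x} with hN
  -- in `R` without `z` and at most one further vertex `y`, one reaches `N` from `Q` inside `W`
  have hreach : ∀ y o, z = y ∨ G.Adj z y → o ∈ Q → o ≠ y → y ∉ M →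
      ∃ n ∈ N, n ≠ y ∧ G.LinkedIn W o n := by
    intro y o hy ho hoy hyM
    have hl := hR.2 z y hy o ⟨hQR ho, by
      simp only [Set.mem_insert_iff, Set.mem_singleton_iff, not_or]
      exact ⟨fun h => hzQ (h ▸ ho), hoy⟩⟩ q ⟨hq, by
      simp only [Set.mem_insert_iff, Set.mem_singleton_iff, not_or]
      exact ⟨hzq.ne', fun h => hyM (h ▸ hqM)⟩⟩
    obtain ⟨x, hx, x', hx', hxR, hxR', hxx'⟩ := hl.exists_exit (D := {x | G.LinkedIn W o x})
      (LinkedIn.refl (hQW ho)) (fun h => h.right_mem.2.1 hqM)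
    simp only [Set.mem_sdiff, Set.mem_insert_iff, Set.mem_singleton_iff, not_or] at hxR hxR'
    have hx'M : x' ∈ M := by
      by_contra h
      have hx'W : x' ∈ W := ⟨hxR'.1, h, hxR'.2.1⟩
      exact hx' (LinkedIn.trans hx (.of_adj hx.right_mem hx'W hxx'))
    exact ⟨x, ⟨hx.right_mem, x', hx'M, hxx'.symm⟩, hxR.2.2, hx⟩
  have hQconn : ∀ x ∈ Q, ∀ y ∈ Q, G.LinkedIn W x y :=
    fun x hx y hy => (hQ.connectedIn x hx y hy).mono hQW
  obtain ⟨n, hn, -, hnlink⟩ := hreach z a (.inl rfl) hQ.left_mem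
    (fun h => hzQ (h ▸ hQ.left_mem)) (fun h => (hMY h).2.1 rfl)
  have hzn : G.Adj z n := by
    obtain ⟨hnW, m, hm, hmn⟩ := hn
    exact hatt m hm n hnW hmn
  obtain ⟨o, ho, hon⟩ : ∃ o ∈ Q, o ≠ n := by
    by_cases h : a = n
    · exact ⟨b, hQ.right_mem, fun h' => hab (h.trans h'.symm)⟩
    · exact ⟨a, hQ.left_mem, h⟩
  obtain ⟨n', hn', hne, hnlink'⟩ := hreach n o (.inr hzn) ho hon hn.1.2.1
  obtain ⟨c, d, S, hSW, hS, ⟨hcN, hdN, hcd⟩, h1, -⟩ :=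
    (hnlink.symm.trans ((hQconn _ hQ.left_mem _ ho).trans hnlink')).exists_minimal_indPath
      (fun u w => u ∈ N ∧ w ∈ N ∧ u ≠ w) ⟨hn, hn', hne.symm⟩
  obtain ⟨hcW, m, hm, hmc⟩ := hcN
  obtain ⟨hdW, m', hm', hmd⟩ := hdN
  obtain ⟨f, f', F, hFM, hF, ⟨hfc, hfd⟩, h3, h4⟩ :=
    (hMconn m hm m' hm').exists_minimal_indPath (fun u w => G.Adj u c ∧ G.Adj w d) ⟨hmc, hmd⟩
  have hSF : Disjoint S F := Set.disjoint_left.2 fun x hx hx' => (hSW hx).2.1 (hFM hx')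
  have hcyc' := hS.indCycle_union hF.symm hcd hSF (by
    intro x hx y hy
    constructor
    · intro hxy
      have hxN : x ∈ N := ⟨hSW hx, y, hFM hy, hxy.symm⟩
      by_cases hxc : x = c
      · subst hxc
        exact .inr ⟨rfl, h4 y hy ⟨hxy.symm, hfd⟩⟩
      · obtain rfl := h1 x hx ⟨⟨hcW, m, hm, hmc⟩, hxN, fun h => hxc h.symm⟩
        exact .inl ⟨rfl, h3 y hy ⟨hfc, hxy.symm⟩⟩
    · rintro (⟨rfl, rfl⟩ | ⟨rfl, rfl⟩)
      exacts [hfd.symm, hfc.symm])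
  refine hcd (hG.eq_of_adj_indCycle hcyc' (x := z) ?_ (.inl hS.left_mem) (.inl hS.right_mem)
    (hatt m hm c hcW hmc) (hatt m' hm' d hdW hmd))
  rintro (h | h)
  exacts [(hSW h).2.2 rfl, (hMY (hFM h)).2.1 rfl]

/-- In a propeller-free graph, any two vertices of a solid set with at least three vertices lie
in a common induced cycle. -/
theorem IsSolid.exists_indCycle_pair [Finite V] {R : Set V} {p q : V} (hR : G.IsSolid R)
    (h3 : 3 ≤ R.ncard) (hG : G.IsInducedPropellerFree) (hp : p ∈ R) (hq : q ∈ R) :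
    ∃ O ⊆ R, G.IndCycle q O ∧ p ∈ O := by
  by_contra hcon
  obtain ⟨O, hOR, hO⟩ := hR.exists_indCycle h3 hp
  obtain ⟨x, ⟨O', hOR', hO', hpO'⟩, y, hy, -, hyR, hxy⟩ := (hR.1 p hp q hq).exists_exit
    (D := {x | ∃ O ⊆ R, G.IndCycle x O ∧ p ∈ O}) ⟨O, hOR, hO, hO.mem⟩ hcon
  exact hy (hR.exists_indCycle_of_adj hG hOR' hO' hpO' hyR hxy)

/-- A vertex outside a solid set with at least three vertices has at most one neighbor in it. -/
theorem IsSolid.eq_of_adj [Finite V] {R : Set V} {x u v : V} (hR : G.IsSolid R)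
    (h3 : 3 ≤ R.ncard) (hG : G.IsInducedPropellerFree) (hx : x ∉ R) (hu : u ∈ R) (hv : v ∈ R)
    (hxu : G.Adj x u) (hxv : G.Adj x v) : u = v := by
  obtain ⟨O, hOR, hO, huO⟩ := hR.exists_indCycle_pair h3 hG hu hv
  exact hG.eq_of_adj_indCycle hO (fun h => hx (hOR h)) huO hO.mem hxu hxv

/-! ### Adding ears to solid sets -/

theorem isSolid_pair {s t : V} (hst : s = t ∨ G.Adj s t) : G.IsSolid {s, t} := by
  have key : ∀ Y ⊆ ({s, t} : Set V), G.ConnectedIn Y := by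
    intro Y hY u hu w hw
    have hu' := hY hu
    have hw' := hY hw
    by_cases huw : u = w
    · exact huw ▸ .refl hu
    · refine .of_adj hu hw ?_
      simp only [Set.mem_insert_iff, Set.mem_singleton_iff] at hu' hw'
      grind [G.adj_comm]
  exact ⟨key _ subset_rfl, fun _ _ _ => key _ Set.sdiff_subset⟩

/-- A solid set stays solid when an ear with nonadjacent feet is added; if the set consists of the
feet alone, these may also be equal or adjacent. -/
theorem IsSolid.union_ear {R P : Set V} {a b s t : V} (hR : G.IsSolid R) (hP : G.IndPath a b P)
    (hd : Disjoint P R) (hs : s ∈ R) (ht : t ∈ R)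
    (hPR : ∀ x ∈ P, ∀ r ∈ R, G.Adj x r ↔ x = a ∧ r = s ∨ x = b ∧ r = t)
    (hst : R = {s, t} ∨ s ≠ t ∧ ¬ G.Adj s t) : G.IsSolid (R ∪ P) := by
  have has : G.Adj a s := (hPR a hP.left_mem s hs).2 (.inl ⟨rfl, rfl⟩)
  have hbt : G.Adj b t := (hPR b hP.right_mem t ht).2 (.inr ⟨rfl, rfl⟩)
  have haR : a ∉ R := Set.disjoint_left.1 hd hP.left_mem
  have hbR : b ∉ R := Set.disjoint_left.1 hd hP.right_mem
  -- it is enough to link the vertices of the ear to one surviving vertex of `R`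
  have key : ∀ K : Set V, G.ConnectedIn (R \ K) → ∀ r ∈ R \ K,
      (∀ w ∈ P \ K, ∃ r' ∈ R \ K, G.LinkedIn ((R ∪ P) \ K) w r') →
      G.ConnectedIn ((R ∪ P) \ K) := by
    intro K hRK r hr hw
    have : ∀ w ∈ (R ∪ P) \ K, G.LinkedIn ((R ∪ P) \ K) w r := by
      have hmono : R \ K ⊆ (R ∪ P) \ K := Set.sdiff_subset_sdiff_left Set.subset_union_left
      rintro w ⟨hwR | hwP, hwK⟩
      · exact (hRK w ⟨hwR, hwK⟩ r hr).mono hmono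
      · obtain ⟨r', hr', h⟩ := hw w ⟨hwP, hwK⟩
        exact h.trans ((hRK r' hr' r hr).mono hmono)
    exact fun u hu w hw => (this u hu).trans (this w hw).symm
  have hmono : ∀ K : Set V, P \ K ⊆ (R ∪ P) \ K := fun K =>
    Set.sdiff_subset_sdiff_left Set.subset_union_right
  have ha' : ∀ K w, G.LinkedIn (P \ K) w a → s ∉ K → ∃ r ∈ R \ K,
      G.LinkedIn ((R ∪ P) \ K) w r := fun K w h hsK => ⟨s, ⟨hs, hsK⟩, (h.mono (hmono K)).trans
    (.of_adj (hmono K h.right_mem) ⟨.inl hs, hsK⟩ has)⟩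
  have hb' : ∀ K w, G.LinkedIn (P \ K) w b → t ∉ K → ∃ r ∈ R \ K,
      G.LinkedIn ((R ∪ P) \ K) w r := fun K w h htK => ⟨t, ⟨ht, htK⟩, (h.mono (hmono K)).trans
    (.of_adj (hmono K h.right_mem) ⟨.inl ht, htK⟩ hbt)⟩
  refine ⟨?_, fun x y hxy => ?_⟩
  · have := key ∅ (by simpa using hR.1) s (by simpa using hs)
      fun w hw => ha' ∅ w (by
        simpa using hP.connectedIn w (by simpa using hw) a hP.left_mem) (by simp)
    simpa using this
  set K : Set V := {x, y} with hK
  have hRK : G.ConnectedIn (R \ K) := hR.2 x y hxy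
  have hKadj : ∀ u ∈ K, ∀ v ∈ K, u = v ∨ G.Adj u v := by
    intro u hu v hv
    simp only [hK, Set.mem_insert_iff, Set.mem_singleton_iff] at hu hv
    grind [G.adj_comm]
  by_cases hsK : s ∈ K <;> by_cases htK : t ∈ K
  · have hRst : R = {s, t} := by
      rcases hst with h | h
      · exact h
      · exact absurd (hKadj s hsK t htK) (by tauto)
    have hRK' : (R ∪ P) \ K = P \ K := by
      rw [Set.union_sdiff_distrib, Set.sdiff_eq_empty.2, Set.empty_union]
      rw [hRst]
      rintro r (rfl | rfl) <;> assumption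
    rw [hRK']
    by_cases hPK : ∃ u ∈ P, u ∈ K
    · obtain ⟨u, huP, huK⟩ := hPK
      have hus : u ≠ s := fun h => Set.disjoint_left.1 hd huP (h ▸ hs)
      have hut : u ≠ t := fun h => Set.disjoint_left.1 hd huP (h ▸ ht)
      have hstu : s = t := by
        simp only [hK, Set.mem_insert_iff, Set.mem_singleton_iff] at hsK htK huK
        grind
      subst hstu
      have hKeq : P \ K = P \ {u} := by
        have : ∀ v ∈ K, v = s ∨ v = u := by
          intro v hv
          simp only [hK, Set.mem_insert_iff, Set.mem_singleton_iff] at hsK hv huK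
          grind
        ext v
        simp only [Set.mem_sdiff, Set.mem_singleton_iff]
        refine ⟨fun h => ⟨h.1, fun h' => h.2 (h' ▸ huK)⟩, fun h => ⟨h.1, fun h' => ?_⟩⟩
        rcases this v h' with rfl | h'
        exacts [Set.disjoint_left.1 hd h.1 hs, h.2 h']
      rw [hKeq]
      have hadj : G.Adj u s := (hKadj u huK s hsK).resolve_left hus
      rcases (hPR u huP s hs).1 hadj with h | h
      exacts [h.1 ▸ hP.connectedIn_diff_left, h.1 ▸ hP.connectedIn_diff_right]
    · push Not at hPK
      rw [sdiff_eq_left.2 (Set.disjoint_left.2 hPK)]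
      exact hP.connectedIn
  · refine key K hRK t ⟨ht, htK⟩ fun w hw => ?_
    have hst' : s ≠ t := fun h => htK (h ▸ hsK)
    rcases hP.linkedIn_diff_pair hxy hw with h | h
    · refine hb' K w ?_ htK
      have hPK : P \ K = P := by
        refine sdiff_eq_left.2 (Set.disjoint_left.2 fun u hu' hu => ?_)
        rcases hKadj u hu s hsK with rfl | h'
        · exact Set.disjoint_left.1 hd hu' hs
        · rcases (hPR u hu' s hs).1 h' with h' | h'
          exacts [h.right_mem.2 (h'.1 ▸ hu), hst' h'.2]
      rw [hPK]
      exact hP.connectedIn w hw.1 b hP.right_mem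
    · exact hb' K w h htK
  · refine key K hRK s ⟨hs, hsK⟩ fun w hw => ?_
    have hst' : s ≠ t := fun h => hsK (h ▸ htK)
    rcases hP.linkedIn_diff_pair hxy hw with h | h
    · exact ha' K w h hsK
    · refine ha' K w ?_ hsK
      have hPK : P \ K = P := by
        refine sdiff_eq_left.2 (Set.disjoint_left.2 fun u hu' hu => ?_)
        rcases hKadj u hu t htK with rfl | h'
        · exact Set.disjoint_left.1 hd hu' ht
        · rcases (hPR u hu' t ht).1 h' with h' | h'
          exacts [hst' h'.2.symm, h.right_mem.2 (h'.1 ▸ hu)]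
      rw [hPK]
      exact hP.connectedIn w hw.1 a hP.left_mem
  · refine key K hRK s ⟨hs, hsK⟩ fun w hw => ?_
    rcases hP.linkedIn_diff_pair hxy hw with h | h
    exacts [ha' K w h hsK, hb' K w h htK]

/-! ### Pending and flat edges away from a solid set -/

/-- The set `X` contains a vertex of degree `1` or two adjacent vertices of degree `2`, where
degrees are taken in `G`. -/
def HasLightEdge (G : SimpleGraph V) (X : Set V) : Prop :=
  (∃ x ∈ X, (G.neighborSet x).ncard = 1) ∨
    ∃ x ∈ X, ∃ y ∈ X, G.Adj x y ∧ (G.neighborSet x).ncard = 2 ∧ (G.neighborSet y).ncard = 2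

theorem HasLightEdge.mono {X Y : Set V} (h : G.HasLightEdge X) (hXY : X ⊆ Y) :
    G.HasLightEdge Y := by
  rcases h with ⟨x, hx, h⟩ | ⟨x, hx, y, hy, h⟩
  exacts [.inl ⟨x, hXY hx, h⟩, .inr ⟨x, hXY hx, y, hXY hy, h⟩]

/-- The first two vertices of an ear have degree `2` if the ear is attached to the rest of the
graph at its feet only. -/
theorem IndPath.hasLightEdge {P R : Set V} {a b s t : V} (hP : G.IndPath a b P) (hab : a ≠ b)
    (hd : Disjoint P R) (hs : s ∈ R) (ht : t ∈ R)
    (hPR : ∀ x ∈ P, ∀ r ∈ R, G.Adj x r ↔ x = a ∧ r = s ∨ x = b ∧ r = t)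
    (hN : ∀ x ∈ P, ∀ y, G.Adj x y → y ∈ P ∨ y ∈ R) : G.HasLightEdge P := by
  have hd' : ∀ x ∈ P, ∀ r ∈ R, x ≠ r := fun x hx r hr h => Set.disjoint_left.1 hd hx (h ▸ hr)
  obtain ⟨a', S, rfl, haS, haa', hS, h1⟩ := hP.exists_eq_insert hab
  have ha'P : a' ∈ insert a S := Or.inr hS.left_mem
  refine .inr ⟨a, .inl rfl, a', ha'P, haa', ?_, ?_⟩
  · rw [Set.ncard_eq_two]
    refine ⟨a', s, hd' a' ha'P s hs, ?_⟩
    ext y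
    simp only [mem_neighborSet, Set.mem_insert_iff, Set.mem_singleton_iff]
    constructor
    · intro h
      rcases hN a (.inl rfl) y h with (rfl | hy) | hy
      · exact absurd h (G.loopless.irrefl _)
      · exact .inl (h1 y hy h)
      · rcases (hPR a (.inl rfl) y hy).1 h with h | h
        exacts [.inr h.2, absurd h.1 hab]
    · rintro (rfl | rfl)
      exacts [haa', (hPR a (.inl rfl) y hs).2 (.inl ⟨rfl, rfl⟩)]
  · rw [Set.ncard_eq_two]
    by_cases hb : a' = b
    · subst hb
      refine ⟨a, t, hd' a (.inl rfl) t ht, ?_⟩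
      have hS' : ∀ y ∈ S, y = a' := by
        intro y hy
        cases hS with
        | single => exact hy
        | cons _ h h' _ => exact absurd h.right_mem h'
      ext y
      simp only [mem_neighborSet, Set.mem_insert_iff, Set.mem_singleton_iff]
      constructor
      · intro h
        rcases hN a' ha'P y h with (rfl | hy) | hy
        · exact .inl rfl
        · exact absurd (hS' y hy) h.ne'
        · rcases (hPR a' ha'P y hy).1 h with h | h
          exacts [absurd h.1 haa'.ne', .inr h.2]
      · rintro (rfl | rfl)
        exacts [haa'.symm, (hPR a' ha'P y ht).2 (.inr ⟨rfl, rfl⟩)]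
    · obtain ⟨c, T, rfl, h2, h3, h4, h5⟩ := hS.exists_eq_insert hb
      refine ⟨a, c, fun h => haS (h ▸ Or.inr h4.left_mem), ?_⟩
      ext y
      simp only [mem_neighborSet, Set.mem_insert_iff, Set.mem_singleton_iff]
      constructor
      · intro h
        rcases hN a' ha'P y h with (rfl | rfl | hy) | hy
        · exact .inl rfl
        · exact absurd h (G.loopless.irrefl _)
        · exact .inr (h5 y hy h)
        · rcases (hPR a' ha'P y hy).1 h with h | h
          exacts [absurd h.1 haa'.ne', absurd h.1 hb]
      · rintro (rfl | rfl)
        exacts [haa'.symm, h3]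

/-- `X` is a nonempty connected set all of whose outer neighbors lie in the disjoint solid set `R`,
there is an edge between `X` and `R`, and each vertex of `X` has at most one neighbor in `R`. -/
structure IsAttached (G : SimpleGraph V) (X R : Set V) : Prop where
  connected : G.ConnectedIn X
  solid : G.IsSolid R
  disjoint : Disjoint X R
  mem_or_mem : ∀ x ∈ X, ∀ y, G.Adj x y → y ∈ X ∨ y ∈ R
  exists_adj : ∃ x ∈ X, ∃ r ∈ R, G.Adj x r
  unique : ∀ x ∈ X, ∀ r ∈ R, ∀ r' ∈ R, G.Adj x r → G.Adj x r' → r = r'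

/-- Each component of what a connected set `X` leaves outside `P` is attached to any solid set that
contains `P` and the outer neighbors of `X`. -/
theorem ConnectedIn.exists_isAttached {X P R : Set V} (hX : G.ConnectedIn X) (hXP : ¬ X ⊆ P)
    (hPX : (P ∩ X).Nonempty) (hR : G.IsSolid R) (hPR : P ⊆ R) (hRX : R ∩ X ⊆ P)
    (hN : ∀ x ∈ X, x ∉ P → ∀ y, G.Adj x y → y ∈ X ∨ y ∈ R)
    (huniq : ∀ x ∉ R, ∀ r ∈ R, ∀ r' ∈ R, G.Adj x r → G.Adj x r' → r = r') :
    ∃ X' ⊂ X, G.IsAttached X' R := by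
  obtain ⟨m, hmX, hmP⟩ := Set.not_subset.1 hXP
  obtain ⟨c, hcP, hcX⟩ := hPX
  have hsub : {x | G.LinkedIn (X \ P) m x} ⊆ X \ P := fun x hx => hx.right_mem
  have hd : ∀ x, G.LinkedIn (X \ P) m x → x ∉ R :=
    fun x hx h => (hsub hx).2 (hRX ⟨h, (hsub hx).1⟩)
  refine ⟨{x | G.LinkedIn (X \ P) m x}, ⟨fun x hx => (hsub hx).1, fun h => (hsub (h hcX)).2 hcP⟩,
    connectedIn_setOf_linkedIn _ _, hR, Set.disjoint_left.2 hd, ?_, ?_, ?_⟩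
  · intro x hx y hxy
    by_cases hyP : y ∈ P
    · exact .inr (hPR hyP)
    · rcases hN x (hsub hx).1 (hsub hx).2 y hxy with h | h
      exacts [.inl (LinkedIn.trans hx (.of_adj (hsub hx) ⟨h, hyP⟩ hxy)), .inr h]
  · obtain ⟨x, hx, y, hy, -, hyX, hxy⟩ := (hX m hmX c hcX).exists_exit
      (D := {x | G.LinkedIn (X \ P) m x}) (LinkedIn.refl ⟨hmX, hmP⟩) (fun h => (hsub h).2 hcP)
    refine ⟨x, hx, y, ?_, hxy⟩
    by_contra hyR
    exact hy (LinkedIn.trans hx (.of_adj (hsub hx) ⟨hyX, fun h => hyR (hPR h)⟩ hxy))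
  · exact fun x hx => huniq x (hd x hx)

/-- If `X` contains an ear `P` of `R`, either `P` is all of `X` and has a flat edge, or a smaller set
than `X` is attached to the enlarged solid set `R ∪ P`. -/
theorem IndPath.hasLightEdge_or_exists_isAttached [Finite V] {X P R : Set V} {a b s t : V}
    (hG : G.IsInducedPropellerFree) (hP : G.IndPath a b P) (hab : a ≠ b) (hPX : P ⊆ X)
    (hX : G.ConnectedIn X) (hR : G.IsSolid R) (hd : Disjoint X R)
    (hN : ∀ x ∈ X, ∀ y, G.Adj x y → y ∈ X ∨ y ∈ R) (hs : s ∈ R) (ht : t ∈ R)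
    (hPR : ∀ x ∈ P, ∀ r ∈ R, G.Adj x r ↔ x = a ∧ r = s ∨ x = b ∧ r = t)
    (hst : R = {s, t} ∨ s ≠ t ∧ ¬ G.Adj s t) :
    G.HasLightEdge X ∨ ∃ X' ⊂ X, ∃ R', G.IsAttached X' R' := by
  have hdP : Disjoint P R := hd.mono_left hPX
  by_cases hXP : X ⊆ P
  · exact .inl ((hP.hasLightEdge hab hdP hs ht hPR fun x hx y hxy =>
      (hN x (hPX hx) y hxy).imp_left (@hXP y)).mono hPX)
  · right
    have hsol := hR.union_ear hP hdP hs ht hPR hst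
    have h3 : 3 ≤ (R ∪ P).ncard := by
      have has : a ≠ s := fun h => Set.disjoint_left.1 hdP hP.left_mem (h ▸ hs)
      have hbs : b ≠ s := fun h => Set.disjoint_left.1 hdP hP.right_mem (h ▸ hs)
      rw [← Set.ncard_eq_three.2 ⟨a, b, s, hab, has, hbs, rfl⟩]
      refine Set.ncard_le_ncard ?_
      rintro x (rfl | rfl | rfl)
      exacts [.inr hP.left_mem, .inr hP.right_mem, .inl hs]
    obtain ⟨X', hX', h⟩ := hX.exists_isAttached hXP ⟨a, hP.left_mem, hPX hP.left_mem⟩ hsol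
      Set.subset_union_right
      (fun x hx => hx.1.resolve_left (Set.disjoint_left.1 hd hx.2))
      (fun x hx _ y hxy => (hN x hx y hxy).imp_right .inl)
      (fun x hx r hr r' hr' => hsol.eq_of_adj h3 hG hx hr hr')
    exact ⟨X', hX', _, h⟩

/-- If some two neighbors of `X` in `R` are distinct and nonadjacent, a shortest path of `X` between
neighbors of such a pair is an ear with nonadjacent feet: a further attachment `c` would be
adjacent to both feet and hence the center of a propeller. -/
theorem IsAttached.exists_ear [Finite V] {X R : Set V} (hG : G.IsInducedPropellerFree)
    (h : G.IsAttached X R) (hex : ∃ u ∈ X, ∃ w ∈ X, ∃ s ∈ R, ∃ t ∈ R,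
      s ≠ t ∧ ¬ G.Adj s t ∧ G.Adj u s ∧ G.Adj w t) :
    ∃ a b P s t, P ⊆ X ∧ G.IndPath a b P ∧ a ≠ b ∧ s ∈ R ∧ t ∈ R ∧ s ≠ t ∧ ¬ G.Adj s t ∧
      ∀ x ∈ P, ∀ r ∈ R, G.Adj x r ↔ x = a ∧ r = s ∨ x = b ∧ r = t := by
  obtain ⟨u, hu, w, hw, hQ⟩ := hex
  obtain ⟨a, b, P, hPX, hP, ⟨s, hs, t, ht, hst, hnst, has, hbt⟩, hmin⟩ :=
    (h.connected u hu w hw).exists_shortest_indPath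
      (fun u w => ∃ s ∈ R, ∃ t ∈ R, s ≠ t ∧ ¬ G.Adj s t ∧ G.Adj u s ∧ G.Adj w t) hQ
  have haX := hPX hP.left_mem
  have hbX := hPX hP.right_mem
  have hab : a ≠ b := by
    rintro rfl
    exact hst (h.unique a haX s hs t ht has hbt)
  refine ⟨a, b, P, s, t, hPX, hP, hab, hs, ht, hst, hnst, ?_⟩
  have hclose : ∀ x ∈ P, ∀ c ∈ R, x ≠ a → x ≠ b → G.Adj x c → G.Adj c s ∧ G.Adj c t := by
    intro x hx c hc hxa hxb hxc
    have hcs : c ≠ s := by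
      rintro rfl
      rcases hmin x hx b hP.right_mem ⟨c, hc, t, ht, hst, hnst, hxc, hbt⟩ with h | h
      exacts [hxa h.1, hxb h.1]
    have hct : c ≠ t := by
      rintro rfl
      rcases hmin a hP.left_mem x hx ⟨s, hs, c, hc, hst, hnst, has, hxc⟩ with h | h
      exacts [hxb h.2, hxa h.2]
    constructor
    · by_contra hn
      rcases hmin x hx a hP.left_mem ⟨c, hc, s, hs, hcs, hn, hxc, has⟩ with h | h
      exacts [hxa h.1, hxb h.1]
    · by_contra hn
      rcases hmin x hx b hP.right_mem ⟨c, hc, t, ht, hct, hn, hxc, hbt⟩ with h | h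
      exacts [hxa h.1, hxb h.1]
  have hint : ∀ x ∈ P, ∀ c ∈ R, G.Adj x c → x = a ∨ x = b := by
    intro x hx c hc hxc
    by_contra! hxab
    obtain ⟨hcs, hct⟩ := hclose x hx c hc hxab.1 hxab.2 hxc
    -- `c` is the only attachment of inner vertices of `P`
    have honly : ∀ y ∈ P, ∀ d ∈ R, y ≠ a → y ≠ b → G.Adj y d → d = c := by
      intro y hy d hd hya hyb hyd
      obtain ⟨hds, hdt⟩ := hclose y hy d hd hya hyb hyd
      by_contra hdc
      by_cases hdc' : G.Adj d c
      · -- `c`, `d`, `s` form a triangle, with center `t`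
        have htri : G.IndCycle d ({d, c} ∪ {s}) := by
          refine IndPath.indCycle_union (.cons hdc' (.single c) (by simpa using hdc) (by simp))
            (.single s) hdc ?_ ?_
          · rw [Set.disjoint_singleton_right]
            rintro (h | h)
            exacts [hds.ne' h, hcs.ne' h]
          · rintro v (rfl | rfl) w rfl
            · simp [hds]
            · simp [hcs]
        refine hdc (hG.eq_of_adj_indCycle htri (x := t) ?_ (by simp) (by simp) hdt.symm hct.symm)
        rintro ((h | h) | h)
        exacts [hdt.ne' h, hct.ne' h, hst h.symm]
      · rcases hmin y hy x hx ⟨d, hd, c, hc, hdc, hdc', hyd, hxc⟩ with h | h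
        exacts [hya h.1, hyb h.1]
    have hl := h.solid.2 c c (.inl rfl)
    rw [Set.pair_eq_singleton] at hl
    obtain ⟨T, hTR, hT⟩ := (hl t ⟨ht, hct.ne'⟩ s ⟨hs, hcs.ne'⟩).exists_indPath
    have hPT : Disjoint P T := h.disjoint.mono hPX (hTR.trans Set.sdiff_subset)
    have hcyc := hP.indCycle_union hT hab hPT (by
      intro y hy r hr
      constructor
      · intro hyr
        by_cases hya : y = a
        · subst hya
          exact .inr ⟨rfl, h.unique y haX r (hTR hr).1 s hs hyr has⟩
        by_cases hyb : y = b
        · subst hyb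
          exact .inl ⟨rfl, h.unique y hbX r (hTR hr).1 t ht hyr hbt⟩
        exact absurd (honly y hy r (hTR hr).1 hya hyb hyr) (hTR hr).2
      · rintro (⟨rfl, rfl⟩ | ⟨rfl, rfl⟩) <;> assumption)
    refine hst (hG.eq_of_adj_indCycle hcyc ?_ (.inr hT.right_mem) (.inr hT.left_mem) hcs hct)
    rintro (h' | h')
    exacts [Set.disjoint_left.1 h.disjoint (hPX h') hc, (hTR h').2 rfl]
  intro x hx r hr
  constructor
  · intro hxr
    rcases hint x hx r hr hxr with rfl | rfl
    exacts [.inl ⟨rfl, h.unique x haX r hr s hs hxr has⟩,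
      .inr ⟨rfl, h.unique x hbX r hr t ht hxr hbt⟩]
  · rintro (⟨rfl, rfl⟩ | ⟨rfl, rfl⟩) <;> assumption

/-- One step of the descent: a set attached to a solid set contains a pending or flat edge, or a
smaller attached set. -/
theorem IsAttached.hasLightEdge_or_exists_isAttached [Finite V] {X R : Set V}
    (hG : G.IsInducedPropellerFree) (h : G.IsAttached X R) :
    G.HasLightEdge X ∨ ∃ X' ⊂ X, ∃ R', G.IsAttached X' R' := by
  by_cases hex : ∃ u ∈ X, ∃ w ∈ X, ∃ s ∈ R, ∃ t ∈ R,
      s ≠ t ∧ ¬ G.Adj s t ∧ G.Adj u s ∧ G.Adj w t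
  · obtain ⟨a, b, P, s, t, hPX, hP, hab, hs, ht, hst, hnst, hPR⟩ := h.exists_ear hG hex
    exact hP.hasLightEdge_or_exists_isAttached hG hab hPX h.connected h.solid h.disjoint
      h.mem_or_mem hs ht hPR (.inr ⟨hst, hnst⟩)
  push Not at hex
  obtain ⟨u, hu, s, hs, hus⟩ := h.exists_adj
  have hsX : s ∉ X := fun h' => Set.disjoint_left.1 h.disjoint h' hs
  by_cases htwo : ∃ w ∈ X, ∃ t ∈ R, t ≠ s ∧ G.Adj w t
  · -- two adjacent attachments `s`, `t`: they close a shortest ear to an induced cycle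
    obtain ⟨w, hw, t, ht, hts, hwt⟩ := htwo
    have htX : t ∉ X := fun h' => Set.disjoint_left.1 h.disjoint h' ht
    have hst : G.Adj s t := by
      by_contra hn
      exact hex u hu w hw s hs t ht hts.symm hn hus hwt
    obtain ⟨a, b, P, hPX, hP, ⟨has, hbt⟩, h1, h2⟩ :=
      (h.connected u hu w hw).exists_minimal_indPath (fun u w => G.Adj u s ∧ G.Adj w t) ⟨hus, hwt⟩
    have hab : a ≠ b := by
      rintro rfl
      exact hts (h.unique a (hPX hP.left_mem) t ht s hs hbt has)
    have hPR : ∀ x ∈ P, ∀ r ∈ ({s, t} : Set V), G.Adj x r ↔ x = a ∧ r = s ∨ x = b ∧ r = t := by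
      rintro x hx r hr
      constructor
      · rintro hxr
        rcases hr with rfl | rfl
        exacts [.inl ⟨h2 x hx ⟨hxr, hbt⟩, rfl⟩, .inr ⟨h1 x hx ⟨has, hxr⟩, rfl⟩]
      · rintro (⟨rfl, rfl⟩ | ⟨rfl, rfl⟩) <;> assumption
    have hd : Disjoint X {s, t} := Set.disjoint_right.2 (by rintro r (rfl | rfl) <;> assumption)
    have hpath : G.IndPath t s {t, s} := .cons hst.symm (.single s) (by simpa using hts) (by simp)
    rw [Set.pair_comm] at hpath
    have hcyc := hP.indCycle_union hpath hab (hd.mono_left hPX)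
      (fun x hx r hr => by rw [hPR x hx r hr, or_comm])
    refine hP.hasLightEdge_or_exists_isAttached (R := {s, t}) hG hab hPX h.connected
      (isSolid_pair (.inr hst)) hd ?_ (.inl rfl) (.inr rfl) hPR (.inl rfl)
    intro x hx y hxy
    refine (h.mem_or_mem x hx y hxy).imp_right fun hy => ?_
    by_contra hyst
    simp only [Set.mem_insert_iff, Set.mem_singleton_iff, not_or] at hyst
    -- a third attachment would be adjacent to both `s` and `t`
    have hys : G.Adj y s := by
      by_contra hn
      exact hex x hx u hu y hy s hs hyst.1 hn hxy hus
    have hyt : G.Adj y t := by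
      by_contra hn
      exact hex x hx w hw y hy t ht hyst.2 hn hxy hwt
    refine hst.ne (hG.eq_of_adj_indCycle hcyc ?_ (.inr (.inl rfl)) (.inr (.inr rfl)) hys hyt)
    rintro (h' | h' | h')
    exacts [Set.disjoint_left.1 h.disjoint (hPX h') hy, hyst.1 h', hyst.2 h']
  push Not at htwo
  have hN : ∀ x ∈ X, ∀ y, G.Adj x y → y ∈ X ∨ y = s := by
    intro x hx y hxy
    refine (h.mem_or_mem x hx y hxy).imp_right fun hy => ?_
    by_contra hys
    exact htwo x hx y hy hys hxy
  by_cases hnb : ∃ w ∈ X, w ≠ u ∧ G.Adj w s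
  · -- a shortest path of `X` between two neighbors of `s` closes to an induced cycle through `s`
    obtain ⟨w, hw, hwu, hws⟩ := hnb
    obtain ⟨a, b, P, hPX, hP, ⟨hab, has, hbs⟩, h1, -⟩ :=
      (h.connected u hu w hw).exists_minimal_indPath
        (fun u w => u ≠ w ∧ G.Adj u s ∧ G.Adj w s) ⟨hwu.symm, hus, hws⟩
    refine hP.hasLightEdge_or_exists_isAttached (R := {s, s}) hG hab hPX h.connected
      (isSolid_pair (.inl rfl)) (by simpa using hsX) (by simpa using hN) (.inl rfl) (.inl rfl) ?_
      (.inl rfl)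
    intro x hx r hr
    obtain rfl : r = s := by simpa using hr
    constructor
    · intro hxr
      by_cases hxa : x = a
      exacts [.inl ⟨hxa, rfl⟩, .inr ⟨h1 x hx ⟨fun h => hxa h.symm, has, hxr⟩, rfl⟩]
    · rintro (⟨rfl, -⟩ | ⟨rfl, -⟩) <;> assumption
  push Not at hnb
  -- `u` is the only vertex of `X` with a neighbor outside `X`
  by_cases hXu : X ⊆ {u}
  · refine .inl (.inl ⟨u, hu, ?_⟩)
    rw [Set.ncard_eq_one]
    refine ⟨s, ?_⟩
    ext y
    simp only [mem_neighborSet, Set.mem_singleton_iff]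
    refine ⟨fun huy => ?_, fun h => h ▸ hus⟩
    exact (hN u hu y huy).resolve_left fun hy => huy.ne (hXu hy).symm
  · obtain ⟨X', hX', h'⟩ := h.connected.exists_isAttached (R := {u, u}) (P := {u}) hXu
      ⟨u, rfl, hu⟩ (isSolid_pair (.inl rfl)) (by simp) (by simp) (by
        refine fun x hx hxu y hxy => (hN x hx y hxy).imp_right fun hy => ?_
        exact absurd (hy ▸ hxy) (hnb x hx hxu)) (by simp)
    exact .inr ⟨X', hX', _, h'⟩

theorem IsAttached.hasLightEdge [Finite V] {X R : Set V} (hG : G.IsInducedPropellerFree)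
    (h : G.IsAttached X R) : G.HasLightEdge X := by
  induction hn : X.ncard using Nat.strong_induction_on generalizing X R with
  | _ n ih =>
    rcases h.hasLightEdge_or_exists_isAttached hG with h | ⟨X', hX', R', h'⟩
    · exact h
    · exact (ih _ (hn ▸ Set.ncard_lt_ncard hX') h' rfl).mono hX'.subset

end SimpleGraph

open SimpleGraph in
theorem mainTheorem5 {V : Type*} [Fintype V] (G : SimpleGraph V) [DecidableRel G.Adj]
    (hG : G.IsInducedPropellerFree) (hE : G.edgeSet.Nonempty) :
    ∃ e : Sym2 V, G.IsPendingEdge e ∨ G.IsFlatEdge e := by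
  obtain ⟨e, he⟩ := hE
  induction e with | _ x y
  rw [mem_edgeSet] at he
  have hdeg : ∀ v, (G.neighborSet v).ncard = G.degree v := fun v => by
    rw [Set.ncard_eq_toFinset_card', ← neighborFinset_def, card_neighborFinset_eq_degree]
  -- the component of `x` in the complement of `y` is attached to `{y}`
  have hatt : G.IsAttached {w | G.LinkedIn {y}ᶜ x w} {y, y} := by
    have hx : G.LinkedIn {y}ᶜ x x := .refl he.ne
    refine ⟨connectedIn_setOf_linkedIn _ _, isSolid_pair (.inl rfl), ?_, ?_,
      ⟨x, hx, y, .inl rfl, he⟩, by simp⟩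
    · rw [Set.pair_eq_singleton, Set.disjoint_singleton_right]
      exact fun h => h.right_mem rfl
    · intro u hu w huw
      by_cases hwy : w = y
      · exact .inr (.inl hwy)
      · exact .inl (LinkedIn.trans hu (.of_adj hu.right_mem hwy huw))
  rcases hatt.hasLightEdge hG with ⟨v, -, hv⟩ | ⟨v, -, w, -, hvw, hv, hw⟩
  · obtain ⟨w, hw⟩ := Set.ncard_eq_one.1 hv
    have hvw : G.Adj v w := by
      rw [← mem_neighborSet, hw]
      rfl
    exact ⟨s(v, w), .inl ⟨hvw, v, Sym2.mem_mk_left v w, by rw [← hdeg, hv]⟩⟩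
  · refine ⟨s(v, w), .inr ⟨hvw, fun z hz => ?_⟩⟩
    rcases Sym2.mem_iff.1 hz with rfl | rfl
    exacts [by rw [← hdeg, hv], by rw [← hdeg, hw]]
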